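/- Let $(\Omega,\mathcal F,\mathbb P)$ be a probability space and let $\lambda,\mu,\nu>0$ and $0<M\le K$ be real numbers. A charging station with $k\in\{0,1,2,\dots\}$ parking spaces, arrival rate $a$, charging rate $\mu$, parking rate $\nu$ and power capacity $m$ is a pair of processes $Q,Z$ with càdlàg paths, $0\le Z(t)\le Q(t)\le k$ integers ($Q$ is the number of parked vehicles, $Z$ the number of those not yet fully charged), random elements of the Skorokhod spaces $D[0,T]$, which almost surely satisfy, for all $t\ge 0$, $$Q(t)=Q(0)+N_{a}\Big(\int_0^t 1_{\{Q(s)<k\}}ds\Big)-N_{\nu,1}\Big(\int_0^t Z(s)\,ds\Big)-N_{\nu,2}\Big(\int_0^t (Q(s)-Z(s))\,ds\Big),$$ $$Z(t)=Z(0)+N_{a}\Big(\int_0^t 1_{\{Q(s)<k\}}ds\Big)-N_{\mu}\Big(\int_0^t \min\{Z(s),m\}\,ds\Big)-N_{\nu,1}\Big(\int_0^t Z(s)\,ds\Big),$$ where $N_a,N_\mu,N_{\nu,1},N_{\nu,2}$ are independent Poisson processes of rates $a,\mu,\nu,\nu$. For each integer $n\ge1$ let $(Q^n,Z^n)$ be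 such a station with $\lfloor nK\rfloor$ parking spaces (that is, $nK$ spaces when $nK$ is an integer), arrival rate $n\lambda$, charging rate $\mu$, parking rate $\nu$ and power capacity $nM$. Suppose that, for some real number $z_0$, as $n\to\infty$, $$\frac{Z^n(0)}{n}\xrightarrow{d} z_0\qquad\text{and}\qquad \frac{Q^n(0)}{n}\xrightarrow{d}K .$$ Then there is a unique continuous function $z:[0,\infty)\to[0,K]$ with $z(0)=z_0$ and $$z'(t)=\min\{\lambda,\nu K\}-\nu z(t)-\mu\min\{z(t),M\}\qquad\text{for all }t\ge0$$ (one-sided derivative at $t=0$), and $\frac{Z^n(\cdot)}{n}\xrightarrow{d}z(\cdot)$ as $n\to\infty$; that is, for every $T>0$ the restrictions to $[0,T]$ converge in distribution in the space $D[0,T]$ with the Skorokhod $J_1$ topology. -/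

import Mathlib

open MeasureTheory ProbabilityTheory Filter Topology
open scoped NNReal ENNReal

noncomputable section

namespace EVCharging

/-! ### The Skorokhod space `D[0,T]` with the `J₁` topology -/

/-- Right continuous with left limits. At the least time the left-limit requirement is void. -/
def IsCadlag {ι : Type*} [Preorder ι] [TopologicalSpace ι] (x : ι → ℝ) : Prop :=
  ∀ t, ContinuousWithinAt x (Set.Ici t) t ∧ ∃ l : ℝ, Tendsto x (𝓝[<] t) (𝓝 l)

/-- The set `D[0,T]` of càdlàg functions `[0,T] → ℝ`. -/
def Skorokhod (T : ℝ≥0) : Type :=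
  {x : Set.Icc (0 : ℝ≥0) T → ℝ // IsCadlag x}

namespace Skorokhod

variable {T : ℝ≥0}

/-- The cost of a time change `γ` (an increasing bijection of `[0,T]`) between two functions:
the larger of `sup |γ(t) - t|` and `sup |x(t) - y(γ(t))|`. -/
def cost (x y : Skorokhod T) (γ : Set.Icc (0 : ℝ≥0) T ≃o Set.Icc (0 : ℝ≥0) T) : ℝ≥0∞ :=
  max (⨆ t, edist (γ t) t) (⨆ t, edist (x.1 t) (y.1 (γ t)))

theorem cost_refl (x : Skorokhod T) : cost x x (OrderIso.refl _) = 0 := by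
  simp [cost]

theorem cost_symm_le (x y : Skorokhod T)
    (γ : Set.Icc (0 : ℝ≥0) T ≃o Set.Icc (0 : ℝ≥0) T) :
    cost y x γ.symm ≤ cost x y γ := by
  refine max_le_max (iSup_le fun t => ?_) (iSup_le fun t => ?_)
  · refine le_trans (le_of_eq ?_) (le_iSup (fun t => edist (γ t) t) (γ.symm t))
    rw [OrderIso.apply_symm_apply, edist_comm]
  · refine le_trans (le_of_eq ?_)
      (le_iSup (fun t => edist (x.1 t) (y.1 (γ t))) (γ.symm t))
    rw [OrderIso.apply_symm_apply, edist_comm]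

theorem cost_trans_le (x y z : Skorokhod T)
    (γ δ : Set.Icc (0 : ℝ≥0) T ≃o Set.Icc (0 : ℝ≥0) T) :
    cost x z (γ.trans δ) ≤ cost x y γ + cost y z δ := by
  refine max_le (iSup_le fun t => ?_) (iSup_le fun t => ?_)
  · calc edist (δ (γ t)) t ≤ edist (δ (γ t)) (γ t) + edist (γ t) t := edist_triangle _ _ _
      _ = edist (γ t) t + edist (δ (γ t)) (γ t) := add_comm _ _
      _ ≤ _ := add_le_add
          ((le_iSup (fun t => edist (γ t) t) t).trans (le_max_left _ _))
          ((le_iSup (fun t => edist (δ t) t) (γ t)).trans (le_max_left _ _))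
  · calc edist (x.1 t) (z.1 (δ (γ t)))
        ≤ edist (x.1 t) (y.1 (γ t)) + edist (y.1 (γ t)) (z.1 (δ (γ t))) := edist_triangle _ _ _
      _ ≤ _ := add_le_add
          ((le_iSup (fun t => edist (x.1 t) (y.1 (γ t))) t).trans (le_max_right _ _))
          ((le_iSup (fun t => edist (y.1 t) (z.1 (δ t))) (γ t)).trans (le_max_right _ _))

/-- The `J₁` metric `d(x,y) = inf_γ max (sup |γ(t) - t|, sup |x(t) - y(γ(t))|)`. -/
instance : PseudoEMetricSpace (Skorokhod T) where
  edist x y := ⨅ γ, cost x y γ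
  edist_self x := le_antisymm (iInf_le_of_le (OrderIso.refl _) (cost_refl x).le) bot_le
  edist_comm x y := le_antisymm
    (le_iInf fun γ => iInf_le_of_le γ.symm (cost_symm_le y x γ))
    (le_iInf fun γ => iInf_le_of_le γ.symm (cost_symm_le x y γ))
  edist_triangle x y z :=
    ENNReal.le_iInf_add_iInf fun γ δ => iInf_le_of_le (γ.trans δ) (cost_trans_le x y z γ δ)

/-- `D[0,T]` carries the Borel σ-algebra of the `J₁` topology. -/
instance : MeasurableSpace (Skorokhod T) := borel _

instance : BorelSpace (Skorokhod T) := ⟨rfl⟩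

/-- The restriction to `[0,T]` of a càdlàg function on `[0,∞)`. -/
def restrict (T : ℝ≥0) (x : ℝ≥0 → ℝ) (hx : IsCadlag x) : Skorokhod T :=
  ⟨fun t => x t, fun t => by
    obtain ⟨h, l, hl⟩ := hx t
    have hc : Continuous (Subtype.val : Set.Icc (0 : ℝ≥0) T → ℝ≥0) := continuous_subtype_val
    refine ⟨h.comp hc.continuousWithinAt fun _ hs => hs, l, hl.comp ?_⟩
    exact tendsto_nhdsWithin_of_tendsto_nhds_of_eventually_within _
      hc.continuousWithinAt (eventually_nhdsWithin_of_forall fun _ hs => hs)⟩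

end Skorokhod

theorem IsCadlag.div_const {ι : Type*} [Preorder ι] [TopologicalSpace ι] {x : ι → ℝ}
    (hx : IsCadlag x) (c : ℝ) : IsCadlag (fun t => x t / c) := fun t =>
  ⟨(hx t).1.div_const c, (hx t).2.elim fun l hl => ⟨l / c, hl.div_const c⟩⟩

theorem isCadlag_of_continuous {ι : Type*} [Preorder ι] [TopologicalSpace ι] {x : ι → ℝ}
    (hx : Continuous x) : IsCadlag x := fun t =>
  ⟨hx.continuousWithinAt, x t, hx.continuousWithinAt⟩

/-! ### The stochastic model -/

/-- `N` is a Poisson process of rate `r` under `P`: it starts at `0`, has nondecreasing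
right-continuous paths, independent increments, and its increment over `[s,t]` has the Poisson
distribution with mean `r (t - s)`. -/
structure IsPoissonProcess {Ω : Type*} [MeasurableSpace Ω] (P : Measure Ω) (r : ℝ)
    (N : ℝ≥0 → Ω → ℕ) : Prop where
  measurable : ∀ t, Measurable (N t)
  paths : ∀ᵐ ω ∂P, N 0 ω = 0 ∧ Monotone (fun t => N t ω) ∧
    ∀ t, ContinuousWithinAt (fun s => N s ω) (Set.Ici t) t
  indep : HasIndepIncrements N P
  law : ∀ s t, s ≤ t →
    HasLaw (fun ω => N t ω - N s ω) (poissonMeasure (r.toNNReal * (t - s))) P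

/-- `clock f t = ∫₀ᵗ f(s) ds` for a nonnegative rate function `f` on `[0,∞)`. -/
def clock (f : ℝ≥0 → ℝ) (t : ℝ≥0) : ℝ≥0 :=
  (∫ s in (0 : ℝ)..t, f s.toNNReal).toNNReal

/-- A charging station with `cap` parking spaces, arrival rate `lam`, charging rate `mu`, parking
rate `nu` and power capacity `M`, on the probability space `(Ω, P)`. `Q` is the number of vehicles
and `Z` the number of uncharged vehicles. -/
structure Station {Ω : Type*} [MeasurableSpace Ω] (P : Measure Ω)
    (cap : ℕ) (lam mu nu M : ℝ) where
  Q : ℝ≥0 → Ω → ℕ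
  Z : ℝ≥0 → Ω → ℕ
  /-- the Poisson process driving arrivals -/
  Nlam : ℝ≥0 → Ω → ℕ
  /-- the Poisson process driving charge completions -/
  Nmu : ℝ≥0 → Ω → ℕ
  /-- the Poisson process driving departures of uncharged vehicles -/
  Nnu1 : ℝ≥0 → Ω → ℕ
  /-- the Poisson process driving departures of fully charged vehicles -/
  Nnu2 : ℝ≥0 → Ω → ℕ
  poisson_lam : IsPoissonProcess P lam Nlam
  poisson_mu : IsPoissonProcess P mu Nmu
  poisson_nu1 : IsPoissonProcess P nu Nnu1
  poisson_nu2 : IsPoissonProcess P nu Nnu2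
  indep : iIndepFun (fun (i : Fin 4) (ω : Ω) (t : ℝ≥0) => ![Nlam, Nmu, Nnu1, Nnu2] i t ω) P
  Q_le_cap : ∀ t ω, Q t ω ≤ cap
  Z_le_Q : ∀ t ω, Z t ω ≤ Q t ω
  measurable_Q : ∀ t, Measurable (Q t)
  measurable_Z : ∀ t, Measurable (Z t)
  cadlag_Q : ∀ ω, IsCadlag (fun t => (Q t ω : ℝ))
  cadlag_Z : ∀ ω, IsCadlag (fun t => (Z t ω : ℝ))
  /-- the processes are random elements of `D[0,T]` -/
  measurable_path_Q : ∀ T, Measurable fun ω => Skorokhod.restrict T _ (cadlag_Q ω)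
  measurable_path_Z : ∀ T, Measurable fun ω => Skorokhod.restrict T _ (cadlag_Z ω)
  eq_Q : ∀ᵐ ω ∂P, ∀ t, (Q t ω : ℤ) = Q 0 ω
    + Nlam (clock (fun s => if Q s ω < cap then 1 else 0) t) ω
    - Nnu1 (clock (fun s => Z s ω) t) ω
    - Nnu2 (clock (fun s => (Q s ω : ℝ) - Z s ω) t) ω
  eq_Z : ∀ᵐ ω ∂P, ∀ t, (Z t ω : ℤ) = Z 0 ω
    + Nlam (clock (fun s => if Q s ω < cap then 1 else 0) t) ω
    - Nmu (clock (fun s => min (Z s ω : ℝ) M) t) ω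
    - Nnu1 (clock (fun s => Z s ω) t) ω

/-- The path of `Z(·) / c` on `[0,T]`. -/
def Station.scaledPath {Ω : Type*} [MeasurableSpace Ω] {P : Measure Ω} {cap : ℕ}
    {lam mu nu M : ℝ} (S : Station P cap lam mu nu M) (c : ℝ) (T : ℝ≥0) (ω : Ω) : Skorokhod T :=
  Skorokhod.restrict T (fun t => (S.Z t ω : ℝ) / c) ((S.cadlag_Z ω).div_const c)

/-! ### The fluid model -/

/-- A continuous `z : [0,∞) → [0,K]` with
`z'(t) = min λ (νK) - ν z(t) - μ min (z(t)) M` for all `t ≥ 0` (one-sided at `t = 0`). -/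
structure IsFluidSolution (lam mu nu K M : ℝ) (z : ℝ≥0 → ℝ) : Prop where
  continuous : Continuous z
  mem_Icc : ∀ t, z t ∈ Set.Icc 0 K
  ode : ∀ t : ℝ≥0, HasDerivWithinAt (fun s : ℝ => z s.toNNReal)
    (min lam (nu * K) - nu * z t - mu * min (z t) M) (Set.Ici 0) t

end EVCharging

end

namespace EVCharging

/-! ### Right-continuous functions and their primitives -/

/-! After division by `n`, the law of large numbers replaces each Poisson process by its mean,
uniformly on compacts. The equation for `Z / n` then becomes the integrated fluid equation, except
that arrivals enter as `lam` times the time during which the station is not full. The crux is that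
this quantity is close to `r * t` with `r = min lam (nu * K)`, although the indicator itself need
not converge pointwise.

This follows from the equation for `q = Q / n` alone: the two departure streams add up to `nu * ∫
q`, so `Z` drops out. Up to small errors `q = K + lam * ∫ i - nu * ∫ q`, where `q` stays below a
level near `K` and `i` vanishes only at that level. `exists_abs_idle_sub_le` compares `q` with the
solution `w` of `w' = r - nu * w`, `w 0 = K`, through an energy estimate for the squared difference.
In it the term `lam * i - r` has a favourable sign, up to the error, whether the station is full or
not.

The rest is perturbation and probability. `abs_sub_fluid_le` is a Gronwall bound for approximate
solutions, and `exists_path_bound` joins it to the idle-time estimate path by path.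
`IsPoissonProcess.measure_exists_dev_le` makes the exceptional events unlikely by Chebyshev on a
grid and monotonicity. A union bound gives convergence in measure in the Skorokhod space, hence in
distribution. The fluid solution itself comes from Picard–Lindelöf for a clipped field and barriers
at `0` and `K`. -/

/-- Right continuity of a function on the real line. -/
def RightCts (f : ℝ → ℝ) : Prop := ∀ t, ContinuousWithinAt f (Set.Ici t) t

/-- Sample `f` at the first point of the grid of mesh `1 / (n + 1)` strictly to the right of `t`.
Each sampled function factors through `ℤ`, and the grid points approach `t` from the right. -/
theorem RightCts.measurable {f : ℝ → ℝ} (hf : RightCts f) : Measurable f := by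
  refine measurable_of_tendsto_metrizable
    (f := fun (n : ℕ) t => f (((⌊((n : ℝ) + 1) * t⌋ : ℝ) + 1) / ((n : ℝ) + 1))) (fun n => ?_) ?_
  · have h : Measurable fun k : ℤ => f (((k : ℝ) + 1) / ((n : ℝ) + 1)) := measurable_of_countable _
    exact h.comp (Int.measurable_floor.comp (measurable_const.mul measurable_id))
  · rw [tendsto_pi_nhds]
    intro t
    refine (hf t).tendsto.comp (tendsto_nhdsWithin_iff.2 ⟨?_, Eventually.of_forall fun n => ?_⟩)
    · refine tendsto_of_tendsto_of_tendsto_of_le_of_le (g := fun _ => t)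
        (h := fun n : ℕ => t + 1 / ((n : ℝ) + 1)) tendsto_const_nhds ?_ (fun n => ?_) (fun n => ?_)
      · simpa using tendsto_const_nhds.add (tendsto_one_div_add_atTop_nhds_zero_nat (𝕜 := ℝ))
      · have hn : (0 : ℝ) < (n : ℝ) + 1 := by positivity
        simp only
        rw [le_div_iff₀ hn]
        linarith [Int.lt_floor_add_one (((n : ℝ) + 1) * t)]
      · have hn : (0 : ℝ) < (n : ℝ) + 1 := by positivity
        simp only
        rw [div_le_iff₀ hn, add_mul t, one_div_mul_cancel hn.ne']
        linarith [Int.floor_le (((n : ℝ) + 1) * t)]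
    · have hn : (0 : ℝ) < (n : ℝ) + 1 := by positivity
      simp only [Set.mem_Ici]
      rw [le_div_iff₀ hn]
      linarith [Int.lt_floor_add_one (((n : ℝ) + 1) * t)]

theorem RightCts.intervalIntegrable {f : ℝ → ℝ} (hf : RightCts f) {C : ℝ} (hC : ∀ t, |f t| ≤ C)
    (a b : ℝ) : IntervalIntegrable f volume a b :=
  (intervalIntegrable_const (c := C)).mono_fun hf.measurable.aestronglyMeasurable
    (Eventually.of_forall fun t => by
      simpa using (hC t).trans (le_abs_self C))

/-- The paths jump, so their primitives have only right derivatives everywhere; the comparison and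
Gronwall lemmas used below need no more. -/
theorem RightCts.hasDerivWithinAt_integral {f : ℝ → ℝ} (hf : RightCts f) {C : ℝ}
    (hC : ∀ t, |f t| ≤ C) (t : ℝ) :
    HasDerivWithinAt (fun u => ∫ s in (0 : ℝ)..u, f s) (f t) (Set.Ici t) t :=
  intervalIntegral.integral_hasDerivWithinAt_right (t := Set.Ioi t) (hf.intervalIntegrable hC 0 t)
    (hf.measurable.stronglyMeasurable.stronglyMeasurableAtFilter)
    ((hf t).mono Set.Ioi_subset_Ici_self)

theorem RightCts.continuous_integral {f : ℝ → ℝ} (hf : RightCts f) {C : ℝ}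
    (hC : ∀ t, |f t| ≤ C) : Continuous fun u => ∫ s in (0 : ℝ)..u, f s :=
  intervalIntegral.continuous_primitive (fun a b => hf.intervalIntegrable hC a b) 0

theorem rightCts_of_isCadlag {f : ℝ≥0 → ℝ} (hf : IsCadlag f) :
    RightCts fun t => f t.toNNReal := fun t =>
  ContinuousWithinAt.comp (g := f) (t := Set.Ici t.toNNReal) (hf t.toNNReal).1
    continuous_real_toNNReal.continuousWithinAt fun _ hs => Real.toNNReal_le_toNNReal hs

/-! ### The idle time of a nearly full station -/

/-- The indicator that the station is not full integrates, up to a small error, to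
`min lam (nu * K) / lam` times the elapsed time. -/
theorem exists_abs_idle_sub_le {lam nu K T : ℝ} (hlam : 0 < lam) (hnu : 0 < nu)
    (hK : 0 < K) (hT : 0 < T) {ε : ℝ} (hε : 0 < ε) :
    ∃ b > 0, ∀ (q i : ℝ → ℝ) (kap : ℝ), RightCts q → RightCts i →
      (∀ t, 0 ≤ q t) → (∀ t, q t ≤ kap) → kap ≤ K → K - kap ≤ b →
      (∀ t, i t = if q t < kap then 1 else 0) →
      (∀ t ∈ Set.Icc 0 T,
        |q t - K - lam * (∫ s in (0 : ℝ)..t, i s) + nu * ∫ s in (0 : ℝ)..t, q s| ≤ b) →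
      ∀ t ∈ Set.Icc 0 T, |lam * (∫ s in (0 : ℝ)..t, i s) - min lam (nu * K) * t| ≤ ε := by
  set r := min lam (nu * K) with hr
  have hr0 : 0 < r := lt_min hlam (by positivity)
  -- `σ` will bound the discrepancy `d`, and the final error is `σ + 2 * nu * σ * T ≤ ε`. The slope
  -- of `d ^ 2` will be at most `B * b`, so `b` is taken with `B * b * T ≤ σ ^ 2`.
  set σ := ε / (2 * (1 + nu * T)) with hσ
  have hσ0 : 0 < σ := by positivity
  set B := 2 * (nu * (K + 1) + 2 * (lam + r)) with hB
  have hB0 : 0 < B := by positivity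
  refine ⟨min (min σ 1) (σ ^ 2 / (B * T)), by positivity, ?_⟩
  set b := min (min σ 1) (σ ^ 2 / (B * T)) with hb
  have hb0 : 0 < b := by positivity
  have hbσ : b ≤ σ := (min_le_left _ _).trans (min_le_left _ _)
  have hb1 : b ≤ 1 := (min_le_left _ _).trans (min_le_right _ _)
  have hbB : B * b * T ≤ σ ^ 2 := by
    have h : b ≤ σ ^ 2 / (B * T) := min_le_right _ _
    rw [le_div_iff₀ (by positivity)] at h
    linarith
  intro q i kap hq hi hq0 hqk hkK hKk hiq hbd
  have hqC : ∀ t, |q t| ≤ K := fun t => by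
    rw [abs_of_nonneg (hq0 t)]; exact (hqk t).trans hkK
  have hiC : ∀ t, |i t| ≤ 1 := fun t => by
    rw [hiq]; split_ifs <;> simp
  -- The fluid limit of `q`: constantly `K` if `nu * K ≤ lam`, otherwise relaxing from `K` to `lam /
  -- nu`.
  set w : ℝ → ℝ := fun t => r / nu + (K - r / nu) * Real.exp (-nu * t) with hw
  have hrK : r / nu ≤ K := by
    rw [div_le_iff₀ hnu]; linarith [min_le_right lam (nu * K)]
  have hw0 : ∀ t, 0 ≤ w t := fun t => by
    have : 0 ≤ (K - r / nu) * Real.exp (-nu * t) :=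
      mul_nonneg (by linarith) (Real.exp_pos _).le
    have : 0 < r / nu := by positivity
    simp only [hw]; linarith
  have hwK : ∀ t, 0 ≤ t → w t ≤ K := fun t ht => by
    have h1 : Real.exp (-nu * t) ≤ 1 := Real.exp_le_one_iff.2 (by nlinarith)
    have := mul_le_mul_of_nonneg_left h1 (sub_nonneg.2 hrK)
    simp only [hw]; linarith
  have hw' : ∀ t, HasDerivAt w (r - nu * w t) t := fun t => by
    have h1 : HasDerivAt (fun t : ℝ => -nu * t) (-nu) t := by
      simpa using (hasDerivAt_id t).const_mul (-nu)
    refine ((h1.exp.const_mul (K - r / nu)).const_add (r / nu)).congr_deriv ?_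
    simp only [hw]; field_simp; ring
  have hwc : Continuous w := by fun_prop
  have hIi := hi.continuous_integral hiC
  have hIq := hq.continuous_integral hqC
  -- `d` is `q - w` with the error removed, so it is continuous although `q` jumps, and `d ^ 2` has
  -- a right derivative.
  set d : ℝ → ℝ := fun t =>
    lam * (∫ s in (0 : ℝ)..t, i s) - nu * (∫ s in (0 : ℝ)..t, q s) - (w t - K) with hd
  have hw00 : w 0 = K := by simp [hw]
  have hd00 : d 0 = 0 := by simp [hd, hw00]
  have hdc : Continuous d := by fun_prop
  have hd' : ∀ t, HasDerivWithinAt d (lam * i t - nu * q t - (r - nu * w t)) (Set.Ici t) t :=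
    fun t => (((hi.hasDerivWithinAt_integral hiC t).const_mul lam).sub
      ((hq.hasDerivWithinAt_integral hqC t).const_mul nu)).sub
      ((hw' t).hasDerivWithinAt.sub_const K)
  clear_value d w b B σ
  have hdη : ∀ t, q t - w t - d t =
      q t - K - lam * (∫ s in (0 : ℝ)..t, i s) + nu * ∫ s in (0 : ℝ)..t, q s := fun t => by
    simp only [hd]; ring
  have hη : ∀ t ∈ Set.Icc 0 T, |q t - w t - d t| ≤ b := fun t ht => by
    rw [hdη]; exact hbd t ht
  have hdb : ∀ t ∈ Set.Ico 0 T,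
      2 * d t * (lam * i t - nu * q t - (r - nu * w t)) ≤ B * b := fun t ht => by
    have h1 := abs_le.1 (hη t ⟨ht.1, ht.2.le⟩)
    have hqt0 := hq0 t
    have hqtk := hqk t
    have hw0t := hw0 t
    have hwKt := hwK t ht.1
    have hdabs : |d t| ≤ K + 1 := abs_le.2 ⟨by linarith, by linarith⟩
    have e1 : d t * (w t - q t) ≤ (K + 1) * b := by
      have h2 : d t * (w t - q t) = -(d t) ^ 2 - d t * (q t - w t - d t) := by ring
      have h3 : -(d t * (q t - w t - d t)) ≤ (K + 1) * b := by
        refine (neg_le_abs _).trans ?_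
        rw [abs_mul]
        exact mul_le_mul hdabs (abs_le.2 h1) (abs_nonneg _) (by linarith)
      nlinarith [sq_nonneg (d t)]
    -- Not full: either `lam = r` and the term vanishes, or `w = K`, so `d` is at most of order `b`
    -- while `lam - r ≥ 0`. Full: `q = kap` is within `b` of `K ≥ w`, so `d ≥ -2 * b` while the
    -- factor is `-r`.
    have e2 : d t * (lam * i t - r) ≤ (lam + r) * (2 * b) := by
      rw [hiq]
      split_ifs with hlt
      · rcases le_total lam (nu * K) with hc | hc
        · have : r = lam := min_eq_left hc
          rw [this]; simp only [mul_one, sub_self, mul_zero]; positivity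
        · have hrr : r = nu * K := min_eq_right hc
          have hwt : w t = K := by
            simp only [hw, hrr]; field_simp; ring
          have hdt : d t ≤ 2 * b := by linarith
          have hlr : 0 ≤ lam * 1 - r := by rw [hrr]; linarith
          calc d t * (lam * 1 - r) ≤ (2 * b) * (lam * 1 - r) :=
                mul_le_mul_of_nonneg_right hdt hlr
            _ ≤ (lam + r) * (2 * b) := by nlinarith
      · have hqe : q t = kap := le_antisymm hqtk (not_lt.1 hlt)
        have hdt : -(2 * b) ≤ d t := by linarith
        nlinarith
    calc 2 * d t * (lam * i t - nu * q t - (r - nu * w t))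
        = 2 * (nu * (d t * (w t - q t)) + d t * (lam * i t - r)) := by ring
      _ ≤ 2 * (nu * ((K + 1) * b) + (lam + r) * (2 * b)) := by gcongr
      _ = B * b := by simp only [hB]; ring
  have hd2 : ∀ t ∈ Set.Icc 0 T, |d t| ≤ σ := fun t ht => by
    have h := image_le_of_deriv_right_le_deriv_boundary (f := fun t => d t ^ 2)
      (f' := fun t => 2 * d t * (lam * i t - nu * q t - (r - nu * w t)))
      (B := fun t => B * b * t) (B' := fun _ => B * b) (a := 0) (b := T)
      (hdc.pow 2).continuousOn
      (fun x _ => ((hd' x).fun_pow 2).congr_deriv (by ring)) (by simp [hd00])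
      (by fun_prop) (fun x _ => by simpa using (hasDerivWithinAt_id x _).const_mul (B * b)) hdb ht
    refine abs_le_of_sq_le_sq (h.trans ?_) hσ0.le
    refine le_trans ?_ hbB
    exact mul_le_mul_of_nonneg_left ht.2 (by positivity)
  have hqw : ∀ t ∈ Set.Icc 0 T, |q t - w t| ≤ 2 * σ := fun t ht => by
    have h1 := abs_le.1 (hη t ht)
    have h2 := abs_le.1 (hd2 t ht)
    exact abs_le.2 ⟨by linarith, by linarith⟩
  intro t ht
  -- Since `w' = r - nu * w`, this function has right derivative `nu * (q - w)`, already known to be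
  -- small; adding `d` to its increment gives the idle-time error.
  have hh := norm_image_sub_le_of_norm_deriv_right_le_segment
    (f := fun t => nu * (∫ s in (0 : ℝ)..t, q s) + w t - r * t) (a := 0) (b := T)
    (f' := fun t => nu * q t + (r - nu * w t) - r) (C := nu * (2 * σ))
    (by fun_prop)
    (fun x _ => (((hq.hasDerivWithinAt_integral hqC x).const_mul nu).add
      (hw' x).hasDerivWithinAt).sub
      (by simpa using (hasDerivWithinAt_id x (Set.Ici x)).const_mul r))
    (fun x hx => by
      rw [Real.norm_eq_abs, show nu * q x + (r - nu * w x) - r = nu * (q x - w x) by ring,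
        abs_mul, abs_of_pos hnu]
      exact mul_le_mul_of_nonneg_left (hqw x ⟨hx.1, hx.2.le⟩) hnu.le) t ht
  simp only [intervalIntegral.integral_same, hw00, Real.norm_eq_abs, sub_zero, mul_zero,
    zero_add] at hh
  have h2 := hd2 t ht
  have hTt : nu * (2 * σ) * t ≤ nu * (2 * σ) * T :=
    mul_le_mul_of_nonneg_left ht.2 (by positivity)
  have hfin : σ + nu * (2 * σ) * T ≤ ε := by
    have : 2 * σ * (1 + nu * T) = ε := by rw [hσ]; field_simp
    nlinarith
  calc |lam * (∫ s in (0 : ℝ)..t, i s) - r * t|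
      = |d t + (nu * (∫ s in (0 : ℝ)..t, q s) + w t - r * t - K)| := by
        simp only [hd]; congr 1; ring
    _ ≤ _ := abs_add_le _ _
    _ ≤ σ + nu * (2 * σ) * T := by linarith
    _ ≤ ε := hfin

/-! ### Stability of the fluid equation -/

theorem abs_min_sub_min_le (a b c : ℝ) : |min a c - min b c| ≤ |a - b| := by
  simpa using abs_min_sub_min_le_max a c b c

/-- A path that satisfies the integrated fluid equation up to an error `δ` stays close to the
fluid solution. -/
theorem abs_sub_fluid_le {r mu nu M z₀ T δ C : ℝ} (hmu : 0 < mu) (hnu : 0 < nu) (hM : 0 < M)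
    {x z : ℝ → ℝ} (hx : RightCts x) (hx0 : ∀ t, 0 ≤ x t) (hxC : ∀ t, x t ≤ C)
    (hzc : Continuous z) (hz0 : z 0 = z₀)
    (hz : ∀ t, 0 ≤ t → HasDerivWithinAt z (r - nu * z t - mu * min (z t) M) (Set.Ici t) t)
    (hδ : ∀ t ∈ Set.Icc 0 T, |x t - z₀ - r * t + mu * (∫ s in (0 : ℝ)..t, min (x s) M)
      + nu * ∫ s in (0 : ℝ)..t, x s| ≤ δ) :
    ∀ t ∈ Set.Icc 0 T, |x t - z t| ≤ δ * Real.exp ((mu + nu) * T) := by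
  have hxC' : ∀ t, |x t| ≤ C := fun t => by rw [abs_of_nonneg (hx0 t)]; exact hxC t
  have hm : RightCts fun t => min (x t) M := fun t => (hx t).min continuousWithinAt_const
  have hmC : ∀ t, |min (x t) M| ≤ M := fun t => by
    rw [abs_of_nonneg (le_min (hx0 t) hM.le)]; exact min_le_right _ _
  have hIx := hx.continuous_integral hxC'
  have hIm := hm.continuous_integral hmC
  -- Gronwall is applied to this continuous substitute for `x - z`, which differs from it by at most
  -- `δ`. It yields `δ * (exp ((mu + nu) * t) - 1)`, and the missing `δ` is restored at the end.
  set e : ℝ → ℝ := fun t => z₀ + r * t - mu * (∫ s in (0 : ℝ)..t, min (x s) M)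
      - nu * (∫ s in (0 : ℝ)..t, x s) - z t with he
  have hec : Continuous e := by fun_prop
  have he0 : e 0 = 0 := by simp [he, hz0]
  have hxe : ∀ t ∈ Set.Icc 0 T, |x t - z t - e t| ≤ δ := fun t ht => by
    convert hδ t ht using 2
    simp only [he]; ring
  have hxz : ∀ t ∈ Set.Icc 0 T, |x t - z t| ≤ |e t| + δ := fun t ht => by
    calc |x t - z t| = |e t + (x t - z t - e t)| := by congr 1; ring
      _ ≤ |e t| + |x t - z t - e t| := abs_add_le _ _
      _ ≤ |e t| + δ := by linarith [hxe t ht]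
  have he' : ∀ t ∈ Set.Ico 0 T, HasDerivWithinAt e
      (r - mu * min (x t) M - nu * x t - (r - nu * z t - mu * min (z t) M)) (Set.Ici t) t :=
    fun t ht => ((((by simpa using (hasDerivWithinAt_id t (Set.Ici t)).const_mul r :
        HasDerivWithinAt (fun t : ℝ => r * t) r (Set.Ici t) t).const_add z₀).sub
      ((hm.hasDerivWithinAt_integral hmC t).const_mul mu)).sub
      ((hx.hasDerivWithinAt_integral hxC' t).const_mul nu)).sub (hz t ht.1)
  intro t ht
  have hδ0 : 0 ≤ δ := (abs_nonneg _).trans (hxe t ht)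
  have hL : 0 < mu + nu := by positivity
  have hg := norm_le_gronwallBound_of_norm_deriv_right_le (f := e) (a := 0) (b := T) (δ := 0)
    (K := mu + nu) (ε := (mu + nu) * δ) hec.continuousOn he' (by simp [he0])
    (fun s hs => by
      have h1 := abs_min_sub_min_le (x s) (z s) M
      have h2 := hxz s ⟨hs.1, hs.2.le⟩
      rw [Real.norm_eq_abs, Real.norm_eq_abs]
      calc _ = |(-mu) * (min (x s) M - min (z s) M) + (-nu) * (x s - z s)| := by congr 1; ring
        _ ≤ |(-mu) * (min (x s) M - min (z s) M)| + |(-nu) * (x s - z s)| := abs_add_le _ _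
        _ = mu * |min (x s) M - min (z s) M| + nu * |x s - z s| := by
          rw [abs_mul, abs_mul, abs_neg, abs_neg, abs_of_pos hmu, abs_of_pos hnu]
        _ ≤ mu * (|e s| + δ) + nu * (|e s| + δ) := by gcongr; exact h1.trans h2
        _ = (mu + nu) * |e s| + (mu + nu) * δ := by ring) t ht
  rw [gronwallBound_of_K_ne_0 hL.ne', Real.norm_eq_abs, mul_div_cancel_left₀ _ hL.ne'] at hg
  simp only [zero_mul, zero_add, sub_zero] at hg
  have hexp : Real.exp ((mu + nu) * t) ≤ Real.exp ((mu + nu) * T) :=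
    Real.exp_le_exp.2 (mul_le_mul_of_nonneg_left ht.2 hL.le)
  have := mul_le_mul_of_nonneg_left hexp hδ0
  linarith [hxz t ht]

/-! ### Existence and uniqueness of the fluid solution -/

/-- A bounded Lipschitz autonomous field on the line has a solution on `[0,∞)` from any point. -/
theorem exists_solution_of_lipschitz_of_bounded {v : ℝ → ℝ} {k L : ℝ≥0} (hv : LipschitzWith k v)
    (hL : ∀ x, ‖v x‖ ≤ L) (x₀ : ℝ) :
    ∃ z : ℝ → ℝ, z 0 = x₀ ∧ ∀ t, 0 ≤ t → HasDerivWithinAt z (v (z t)) (Set.Ici 0) t := by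
  have hloc : ∀ n : ℕ, ∃ α : ℝ → ℝ, α 0 = x₀ ∧ ∀ t ∈ Set.Icc (0 : ℝ) (n + 1),
      HasDerivWithinAt α (v (α t)) (Set.Icc (0 : ℝ) (n + 1)) t := fun n => by
    -- A field bounded by `L` cannot leave the ball of radius `L * (n + 1)` within time `n + 1`, so
    -- one Picard–Lindelöf step covers the whole interval.
    have hp : IsPicardLindelof (fun _ => v) (tmin := 0) (tmax := n + 1)
        ⟨0, by constructor <;> positivity⟩ x₀ (L * (n + 1)) 0 L k :=
      { lipschitzOnWith := fun _ _ => hv.lipschitzOnWith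
        continuousOn := fun _ _ => continuousOn_const
        norm_le := fun _ _ x _ => hL x
        mul_max_le := by
          have : (0 : ℝ) ≤ n + 1 := by positivity
          simp [max_eq_left this] }
    exact hp.exists_eq_forall_mem_Icc_hasDerivWithinAt₀
  choose α hα0 hα using hloc
  have hIci : ∀ n : ℕ, ∀ t ∈ Set.Ico (0 : ℝ) (n + 1),
      HasDerivWithinAt (α n) (v (α n t)) (Set.Ici t) t := fun n t ht =>
    ((hα n t ⟨ht.1, ht.2.le⟩).mono (Set.Icc_subset_Icc_left ht.1)).mono_of_mem_nhdsWithin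
      (Icc_mem_nhdsGE ht.2)
  have heq : ∀ m n : ℕ, m ≤ n → ∀ t ∈ Set.Icc (0 : ℝ) (m + 1), α m t = α n t := fun m n hmn => by
    have hmn' : (m : ℝ) + 1 ≤ n + 1 := by exact_mod_cast Nat.succ_le_succ hmn
    exact ODE_solution_unique (v := fun _ => v) (fun _ => hv)
      (fun t ht => (hα m t ht).continuousWithinAt) (fun t ht => hIci m t ht)
      (fun t ht => ((hα n t ⟨ht.1, ht.2.trans hmn'⟩).continuousWithinAt).mono
        (Set.Icc_subset_Icc_right hmn'))
      (fun t ht => hIci n t ⟨ht.1, ht.2.trans_le hmn'⟩) (by rw [hα0, hα0])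
  refine ⟨fun t => α ⌊t⌋₊ t, by simp [hα0], fun t ht => ?_⟩
  -- By uniqueness on overlaps, a single local solution represents the glued function on a
  -- neighbourhood of `t` in the half-line.
  have hglue : ∀ s ∈ Set.Icc (0 : ℝ) ((⌊t⌋₊ + 1 : ℕ) + 1), α ⌊s⌋₊ s = α (⌊t⌋₊ + 1) s := fun s hs => by
    have hfl : s ∈ Set.Icc (0 : ℝ) (⌊s⌋₊ + 1) := ⟨hs.1, (Nat.lt_floor_add_one s).le⟩
    rcases le_total ⌊s⌋₊ (⌊t⌋₊ + 1) with h | h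
    · exact heq _ _ h s hfl
    · exact (heq _ _ h s hs).symm
  have htlt : t < ((⌊t⌋₊ + 1 : ℕ) : ℝ) + 1 := by
    push_cast; linarith [Nat.lt_floor_add_one t]
  have hmem : t ∈ Set.Icc (0 : ℝ) ((⌊t⌋₊ + 1 : ℕ) + 1) := ⟨ht, htlt.le⟩
  have h1 := (hα (⌊t⌋₊ + 1) t hmem).congr hglue (hglue t hmem)
  rw [← hglue t hmem] at h1
  refine h1.mono_of_mem_nhdsWithin ?_
  rw [← Set.Ici_inter_Iic]
  exact inter_mem_nhdsWithin _ (Iic_mem_nhds htlt)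

/-- The fluid equation in terms of right derivatives on the half-line. -/
theorem IsFluidSolution.hasDerivWithinAt {lam mu nu K M : ℝ} {y : ℝ≥0 → ℝ}
    (hy : IsFluidSolution lam mu nu K M y) {t : ℝ} (ht : 0 ≤ t) :
    HasDerivWithinAt (fun s : ℝ => y s.toNNReal) (min lam (nu * K) - nu * y t.toNNReal
      - mu * min (y t.toNNReal) M) (Set.Ici t) t := by
  have := hy.ode t.toNNReal
  rw [Real.coe_toNNReal t ht] at this
  exact this.mono (Set.Ici_subset_Ici.2 ht)

theorem lipschitzWith_fluid_field {r mu nu M : ℝ} (hmu : 0 < mu) (hnu : 0 < nu) :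
    LipschitzWith (nu + mu).toNNReal fun x : ℝ => r - nu * x - mu * min x M :=
  LipschitzWith.of_dist_le_mul fun x y => by
    rw [Real.dist_eq, Real.dist_eq, Real.coe_toNNReal _ (by positivity)]
    have h1 := abs_min_sub_min_le x y M
    calc |r - nu * x - mu * min x M - (r - nu * y - mu * min y M)|
        = |(-nu) * (x - y) + (-mu) * (min x M - min y M)| := by congr 1; ring
      _ ≤ |(-nu) * (x - y)| + |(-mu) * (min x M - min y M)| := abs_add_le _ _
      _ = nu * |x - y| + mu * |min x M - min y M| := by
        rw [abs_mul, abs_mul, abs_neg, abs_neg, abs_of_pos hmu, abs_of_pos hnu]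
      _ ≤ nu * |x - y| + mu * |x - y| := by gcongr
      _ = _ := by ring

theorem IsFluidSolution.eq_of_initial_eq {lam mu nu K M : ℝ} (hmu : 0 < mu) (hnu : 0 < nu)
    {y z : ℝ≥0 → ℝ} (hy : IsFluidSolution lam mu nu K M y) (hz : IsFluidSolution lam mu nu K M z)
    (h0 : y 0 = z 0) : y = z := by
  funext t
  have hu := ODE_solution_unique (f := fun s : ℝ => y s.toNNReal) (g := fun s : ℝ => z s.toNNReal)
    (a := 0) (b := t) (v := fun _ x => min lam (nu * K) - nu * x - mu * min x M)
    (fun _ => lipschitzWith_fluid_field hmu hnu)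
    (hy.continuous.comp continuous_real_toNNReal).continuousOn
    (fun s hs => hy.hasDerivWithinAt hs.1)
    (hz.continuous.comp continuous_real_toNNReal).continuousOn
    (fun s hs => hz.hasDerivWithinAt hs.1) (by simpa using h0) (x := t) ⟨t.2, le_rfl⟩
  simpa using hu

theorem exists_isFluidSolution {lam mu nu K M z₀ : ℝ} (hlam : 0 < lam) (hmu : 0 < mu)
    (hnu : 0 < nu) (hM : 0 < M) (hMK : M ≤ K) (hz₀ : z₀ ∈ Set.Icc 0 K) :
    ∃ z : ℝ≥0 → ℝ, IsFluidSolution lam mu nu K M z ∧ z 0 = z₀ := by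
  have hK : 0 < K := hM.trans_le hMK
  set r := min lam (nu * K) with hr
  have hr0 : 0 < r := lt_min hlam (by positivity)
  have hrK : r ≤ nu * K := min_le_right _ _
  -- Clipping to `[0, K]` makes the field bounded. The clipped field is at most `-mu * M < 0` at `K`
  -- and equals `r > 0` at `0`, so solutions stay in `[0, K]`, where clipping changes nothing.
  set φ : ℝ → ℝ := fun x => max 0 (min x K) with hφ
  have hφ1 : LipschitzWith 1 φ := LipschitzWith.const_max (LipschitzWith.id.min_const K) 0
  have hφ0 : ∀ x, 0 ≤ φ x := fun x => le_max_left _ _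
  have hφK : ∀ x, φ x ≤ K := fun x => max_le hK.le (min_le_right _ _)
  set v : ℝ → ℝ := fun x => r - nu * φ x - mu * min (φ x) M with hv
  have hvl : LipschitzWith ((nu + mu).toNNReal * 1) v :=
    (lipschitzWith_fluid_field hmu hnu).comp hφ1
  have hvb : ∀ x, ‖v x‖ ≤ (nu * K + mu * M).toNNReal := fun x => by
    have h1 := mul_le_mul_of_nonneg_left (hφK x) hnu.le
    have h2 := mul_le_mul_of_nonneg_left (min_le_right (φ x) M) hmu.le
    have h3 := mul_nonneg hnu.le (hφ0 x)
    have h4 := mul_nonneg hmu.le (le_min (hφ0 x) hM.le)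
    rw [Real.coe_toNNReal _ (by positivity), Real.norm_eq_abs]
    have : 0 < mu * M := by positivity
    exact abs_le.2 ⟨by simp only [hv]; linarith, by simp only [hv]; linarith⟩
  obtain ⟨z, hz0, hz⟩ := exists_solution_of_lipschitz_of_bounded hvl hvb z₀
  have hzc : ContinuousOn z (Set.Ici 0) := fun t ht => (hz t ht).continuousWithinAt
  have hz' : ∀ t, 0 ≤ t → HasDerivWithinAt z (v (z t)) (Set.Ici t) t := fun t ht =>
    (hz t ht).mono (Set.Ici_subset_Ici.2 ht)
  have hup : ∀ t, 0 ≤ t → z t ≤ K := fun t ht =>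
    image_le_of_deriv_right_lt_deriv_boundary' (f := z) (f' := fun s => v (z s)) (a := 0) (b := t)
      (B := fun _ => K) (B' := fun _ => 0)
      (hzc.mono Set.Icc_subset_Ici_self) (fun s hs => hz' s hs.1) (hz0 ▸ hz₀.2)
      continuousOn_const (fun s _ => hasDerivWithinAt_const _ _ _)
      (fun s _ hs => by
        have hφs : φ (z s) = K := by simp [hφ, hs, hK.le]
        have : 0 < mu * M := by positivity
        simp only [hv, hφs, min_eq_right hMK]
        linarith) ⟨ht, le_rfl⟩
  have hlo : ∀ t, 0 ≤ t → 0 ≤ z t := fun t ht => by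
    have := image_le_of_deriv_right_lt_deriv_boundary' (f := fun s => -z s)
      (f' := fun s => -v (z s)) (a := 0) (b := t)
      (B := fun _ => 0) (B' := fun _ => 0)
      (hzc.mono Set.Icc_subset_Ici_self).neg (fun s hs => (hz' s hs.1).neg)
      (by simpa [hz0] using hz₀.1)
      continuousOn_const (fun s _ => hasDerivWithinAt_const _ _ _)
      (fun s _ hs => by
        have hzs : z s = 0 := by simpa using hs
        have hφs : φ (z s) = 0 := by simp [hφ, hzs]
        simp only [hv, hφs, min_eq_left hM.le]
        linarith) (x := t) ⟨ht, le_rfl⟩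
    simpa using this
  have hφz : ∀ t, 0 ≤ t → φ (z t) = z t := fun t ht => by
    simp [hφ, min_eq_left (hup t ht), hlo t ht]
  refine ⟨fun t => z t, ⟨?_, fun t => ⟨hlo t t.2, hup t t.2⟩, fun t => ?_⟩, by simpa using hz0⟩
  · exact hzc.comp_continuous NNReal.continuous_coe fun t => t.2
  · have h := hz t t.2
    simp only [hv, hφz t t.2] at h
    refine h.congr (fun s hs => ?_) (by simp)
    simp [Real.coe_toNNReal s hs]

/-! ### A maximal inequality for Poisson processes -/

/-- The Poisson variance. The shift identity `p (n + 1) * (n + 1) = r * p n` reduces the first two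
moments to the total mass. -/
theorem hasSum_poisson_sq_dev (r : ℝ≥0) :
    HasSum (fun n : ℕ => Real.exp (-r) * r ^ n / n.factorial * ((n : ℝ) - r) ^ 2) r := by
  set p : ℕ → ℝ := fun n => Real.exp (-r) * (r : ℝ) ^ n / n.factorial with hp
  have h0 : HasSum p 1 := hasSum_one_poissonMeasure r
  have hs : ∀ n : ℕ, p (n + 1) * ((n : ℝ) + 1) = r * p n := fun n => by
    simp only [hp, Nat.factorial_succ, pow_succ]; push_cast; field_simp
  have h1 : HasSum (fun n : ℕ => p n * n) r := by
    have h := h0.mul_left (r : ℝ)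
    rw [mul_one] at h
    have h2 := (hasSum_nat_add_iff (f := fun n : ℕ => p n * n) (g := (r : ℝ)) 1).1
      (by simpa [hs] using h)
    simpa using h2
  have h2 : HasSum (fun n : ℕ => p n * (n : ℝ) ^ 2) (r * r + r) := by
    have h := (h1.add h0).mul_left (r : ℝ)
    have h2 := (hasSum_nat_add_iff (f := fun n : ℕ => p n * (n : ℝ) ^ 2) (g := (r * (r + 1) : ℝ)) 1).1
      (by
        have e : (fun n : ℕ => p (n + 1) * ((n + 1 : ℕ) : ℝ) ^ 2) =
            fun n : ℕ => (r : ℝ) * (p n * n + p n) := by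
          funext n
          push_cast
          linear_combination ((n : ℝ) + 1) * hs n
        rw [e]
        exact h)
    simp only [Finset.range_one, Finset.sum_singleton, Nat.cast_zero] at h2
    rwa [show (r : ℝ) * (r + 1) + p 0 * 0 ^ 2 = r * r + r by ring] at h2
  have h := (h2.sub (h1.mul_left (2 * (r : ℝ)))).add (h0.mul_left ((r : ℝ) ^ 2))
  rw [show (r : ℝ) * r + r - 2 * r * r + r ^ 2 * 1 = r by ring] at h
  exact (funext fun n => by simp only [hp]; ring :
    (fun n : ℕ => p n * (n : ℝ) ^ 2 - 2 * r * (p n * n) + r ^ 2 * p n) =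
      fun n : ℕ => Real.exp (-r) * r ^ n / n.factorial * ((n : ℝ) - r) ^ 2) ▸ h

theorem poissonMeasure_dev_le (r : ℝ≥0) {a : ℝ} (ha : 0 < a) :
    (poissonMeasure r) {n : ℕ | a ≤ |(n : ℝ) - r|} ≤ ENNReal.ofReal (r / a ^ 2) := by
  have hsum := hasSum_poisson_sq_dev r
  have hint : Integrable (fun n : ℕ => ((n : ℝ) - r) ^ 2) (poissonMeasure r) := by
    rw [integrable_poissonMeasure_iff]
    refine hsum.summable.congr fun n => ?_
    rw [Real.norm_of_nonneg (sq_nonneg _)]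
  have hval : ∫ n : ℕ, ((n : ℝ) - r) ^ 2 ∂(poissonMeasure r) = r := by
    have := hasSum_integral_poissonMeasure hint
    exact this.unique (by simpa using hsum)
  have hm := mul_meas_ge_le_integral_of_nonneg (μ := poissonMeasure r)
    (f := fun n : ℕ => ((n : ℝ) - r) ^ 2) (Eventually.of_forall fun n => sq_nonneg _) hint (a ^ 2)
  rw [hval] at hm
  have hset : {n : ℕ | a ≤ |(n : ℝ) - r|} ⊆ {n : ℕ | a ^ 2 ≤ ((n : ℝ) - r) ^ 2} := fun n hn => by
    simp only [Set.mem_ofPred_eq] at hn ⊢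
    rw [← sq_abs ((n : ℝ) - r)]
    exact pow_le_pow_left₀ ha.le hn 2
  refine (measure_mono hset).trans ?_
  rw [ENNReal.le_ofReal_iff_toReal_le (measure_ne_top _ _) (by positivity), ← measureReal_def,
    le_div_iff₀ (by positivity)]
  linarith

variable {Ω : Type*} [MeasurableSpace Ω] {P : Measure Ω}

theorem IsPoissonProcess.measure_dev_le {rho : ℝ} (hrho : 0 ≤ rho) {N : ℝ≥0 → Ω → ℕ}
    (hN : IsPoissonProcess P rho N) (t : ℝ≥0) {a : ℝ} (ha : 0 < a) :
    P {ω | a ≤ |(N t ω : ℝ) - rho * t|} ≤ ENNReal.ofReal (rho * t / a ^ 2) := by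
  have hl := hN.law 0 t (zero_le)
  have hr : ((rho.toNNReal * (t - 0) : ℝ≥0) : ℝ) = rho * t := by
    simp [Real.coe_toNNReal _ hrho]
  have h := poissonMeasure_dev_le (rho.toNNReal * (t - 0)) ha
  rw [← hl.map_eq, Measure.map_apply_of_aemeasurable hl.aemeasurable .of_discrete, hr] at h
  refine le_trans (measure_mono_ae ?_) h
  filter_upwards [hN.paths] with ω hω hmem
  have hmem' : a ≤ |(N t ω : ℝ) - rho * t| := hmem
  change a ≤ |((N t ω - N 0 ω : ℕ) : ℝ) - rho * t|
  rwa [hω.1, Nat.sub_zero]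

/-- Over `[0,L]`, a Poisson process deviates from its mean by more than `a` only with a probability
controlled by a grid of mesh `L / m`. -/
theorem IsPoissonProcess.measure_exists_dev_le {rho : ℝ} (hrho : 0 ≤ rho) {N : ℝ≥0 → Ω → ℕ}
    (hN : IsPoissonProcess P rho N) (L : ℝ≥0) {a : ℝ} (ha : 0 < a) {m : ℕ} (hm : 0 < m)
    (hmL : rho * L / m ≤ a / 2) :
    P {ω | ∃ s ≤ L, a < |(N s ω : ℝ) - rho * s|} ≤
      (m + 1) * ENNReal.ofReal (4 * (rho * L) / a ^ 2) := by
  have hm' : (0 : ℝ) < m := by exact_mod_cast hm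
  set g : ℕ → ℝ≥0 := fun i => L * i / m with hg
  have hgr : ∀ i, ((g i : ℝ≥0) : ℝ) = L * i / m := fun i => by simp [hg]
  have hsub : {ω | ∃ s ≤ L, a < |(N s ω : ℝ) - rho * s|} ≤ᵐ[P]
      ⋃ i ∈ Finset.range (m + 1), {ω | a / 2 ≤ |(N (g i) ω : ℝ) - rho * g i|} := by
    filter_upwards [hN.paths] with ω hω
    rintro ⟨s, hsL, hs⟩
    show ω ∈ ⋃ i ∈ Finset.range (m + 1), {ω | a / 2 ≤ |(N (g i) ω : ℝ) - rho * g i|}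
    by_contra hcon
    simp only [Set.mem_iUnion, Set.mem_ofPred_eq, not_exists, not_le, Finset.mem_range] at hcon
    have hmono := hω.2.1
    -- `N` and its mean are both monotone, so on a grid cell `N s` lies between the endpoint values
    -- while the mean moves by at most `a / 2`. The endpoint `s = L` is separate because the floor
    -- would give the nonexistent cell `m`.
    have key : ∃ i < m, g i ≤ s ∧ s ≤ g (i + 1) := by
      rcases eq_or_lt_of_le (zero_le (a := L)) with hL | hL
      · refine ⟨0, hm, by simp [hg], ?_⟩
        have : s = 0 := le_antisymm (hsL.trans hL.ge) (zero_le)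
        simp [this]
      · have hL' : (0 : ℝ) < L := hL
        have hsL' : (s : ℝ) ≤ L := hsL
        rcases eq_or_lt_of_le hsL with h | h
        · refine ⟨m - 1, by omega, ?_, ?_⟩
          · rw [h, ← NNReal.coe_le_coe, hgr, div_le_iff₀ hm']
            have : ((m - 1 : ℕ) : ℝ) ≤ m := by exact_mod_cast Nat.sub_le _ _
            exact mul_le_mul_of_nonneg_left this hL'.le
          · rw [h, ← NNReal.coe_le_coe, hgr, Nat.sub_add_cancel hm, mul_div_cancel_right₀ _ hm'.ne']
        · have h' : (s : ℝ) < L := h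
          refine ⟨⌊(s : ℝ) * m / L⌋₊, ?_, ?_, ?_⟩
          · rw [Nat.floor_lt (by positivity), div_lt_iff₀ hL']
            nlinarith
          · rw [← NNReal.coe_le_coe, hgr, div_le_iff₀ hm']
            have := Nat.floor_le (show (0 : ℝ) ≤ (s : ℝ) * m / L by positivity)
            rw [le_div_iff₀ hL'] at this
            linarith
          · rw [← NNReal.coe_le_coe, hgr, le_div_iff₀ hm']
            have := (Nat.lt_floor_add_one ((s : ℝ) * m / L)).le
            rw [div_le_iff₀ hL'] at this
            push_cast
            linarith
    obtain ⟨i, him, hi1, hi2⟩ := key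
    have c1 := abs_lt.1 (hcon i (by omega))
    have c2 := abs_lt.1 (hcon (i + 1) (by omega))
    have n1 : (N (g i) ω : ℝ) ≤ N s ω := by exact_mod_cast hmono hi1
    have n2 : (N s ω : ℝ) ≤ N (g (i + 1)) ω := by exact_mod_cast hmono hi2
    have r1 : rho * (g i : ℝ) ≤ rho * s := mul_le_mul_of_nonneg_left hi1 hrho
    have r2 : rho * (s : ℝ) ≤ rho * g (i + 1) := mul_le_mul_of_nonneg_left hi2 hrho
    have hstep : rho * (g (i + 1) : ℝ) - rho * g i = rho * L / m := by
      rw [hgr, hgr]; push_cast; field_simp; ring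
    rcases lt_abs.1 hs with h | h <;> linarith
  calc P {ω | ∃ s ≤ L, a < |(N s ω : ℝ) - rho * s|}
      ≤ P (⋃ i ∈ Finset.range (m + 1), {ω | a / 2 ≤ |(N (g i) ω : ℝ) - rho * g i|}) :=
        measure_mono_ae hsub
    _ ≤ ∑ i ∈ Finset.range (m + 1), P {ω | a / 2 ≤ |(N (g i) ω : ℝ) - rho * g i|} :=
        measure_biUnion_finset_le _ _
    _ ≤ ∑ _i ∈ Finset.range (m + 1), ENNReal.ofReal (4 * (rho * L) / a ^ 2) := by
        refine Finset.sum_le_sum fun i hi => ?_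
        refine (hN.measure_dev_le hrho (g i) (half_pos ha)).trans (ENNReal.ofReal_le_ofReal ?_)
        have hgL : (g i : ℝ) ≤ L := by
          rw [hgr, div_le_iff₀ hm']
          have : (i : ℝ) ≤ m := by exact_mod_cast Nat.lt_succ_iff.1 (Finset.mem_range.1 hi)
          exact mul_le_mul_of_nonneg_left this L.2
        have e : rho * (g i : ℝ) / (a / 2) ^ 2 = 4 * (rho * g i) / a ^ 2 := by
          field_simp; norm_num
        rw [e]
        gcongr
    _ = (m + 1) * ENNReal.ofReal (4 * (rho * L) / a ^ 2) := by
        rw [Finset.sum_const, Finset.card_range, nsmul_eq_mul]; push_cast; rfl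

/-- The weak law of large numbers, uniformly on compact time intervals, for Poisson processes with
total mass of order `n`. -/
theorem tendsto_measure_poisson_dev {rho : ℕ+ → ℝ} (hrho : ∀ n, 0 ≤ rho n)
    {N : ℕ+ → ℝ≥0 → Ω → ℕ} (hN : ∀ n, IsPoissonProcess P (rho n) (N n)) {L : ℕ+ → ℝ≥0} {C : ℝ}
    (hC : ∀ n, rho n * L n ≤ C * n) {b : ℝ} (hb : 0 < b) :
    Tendsto (fun n : ℕ+ => P {ω | ∃ s ≤ L n, b * n < |(N n s ω : ℝ) - rho n * s|}) atTop (𝓝 0) := by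
  -- The number of grid cells does not depend on `n`: the mean per cell is at most `C * n / m ≤ b *
  -- n / 2`, and each Chebyshev term is of order `1 / n`.
  obtain ⟨m, hm⟩ := exists_nat_gt (max 0 (2 * C / b))
  have hm0 : (0 : ℝ) < m := (le_max_left _ _).trans_lt hm
  have hmC : 2 * C ≤ b * m := by
    have := (le_max_right _ _).trans hm.le
    rw [div_le_iff₀ hb] at this
    linarith
  have hbd : ∀ n : ℕ+, P {ω | ∃ s ≤ L n, b * n < |(N n s ω : ℝ) - rho n * s|} ≤
      (m + 1) * ENNReal.ofReal (4 * C / b ^ 2 / (n : ℕ)) := fun n => by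
    have hn : (0 : ℝ) < (n : ℕ) := by exact_mod_cast n.pos
    refine ((hN n).measure_exists_dev_le (hrho n) (L n) (a := b * n) (by positivity) (m := m)
      (by exact_mod_cast hm0) ?_).trans ?_
    · rw [div_le_iff₀ hm0]
      nlinarith [hC n]
    · refine mul_le_mul_right (ENNReal.ofReal_le_ofReal ?_) _
      rw [div_div, div_le_div_iff₀ (by positivity) (by positivity)]
      have := mul_le_mul_of_nonneg_left (hC n) (show (0 : ℝ) ≤ 4 * (b ^ 2 * n) by positivity)
      nlinarith
  have hlim : Tendsto (fun n : ℕ => ((m : ℝ≥0∞) + 1) * ENNReal.ofReal (4 * C / b ^ 2 / n))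
      atTop (𝓝 0) := by
    have h1 := ENNReal.tendsto_ofReal (tendsto_const_div_atTop_nhds_zero_nat (4 * C / b ^ 2))
    rw [ENNReal.ofReal_zero] at h1
    have h2 := ENNReal.Tendsto.const_mul (a := (m : ℝ≥0∞) + 1) h1
      (Or.inr (by exact ENNReal.add_ne_top.2 ⟨ENNReal.natCast_ne_top m, ENNReal.one_ne_top⟩))
    simpa using h2
  exact tendsto_of_tendsto_of_tendsto_of_le_of_le tendsto_const_nhds
    (hlim.comp tendsto_PNat_val_atTop_atTop) (fun _ => zero_le) hbd

/-! ### Random clocks -/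

theorem coe_clock {f : ℝ≥0 → ℝ} (hf0 : ∀ t, 0 ≤ f t) (t : ℝ≥0) :
    (clock f t : ℝ) = ∫ s in (0 : ℝ)..t, f s.toNNReal :=
  Real.coe_toNNReal _ (intervalIntegral.integral_nonneg t.2 fun _ _ => hf0 _)

/-- Confines the random clocks to a deterministic interval, so that uniform control of the Poisson
processes there can be evaluated at random times. -/
theorem clock_le {f : ℝ≥0 → ℝ} (hf : RightCts fun t => f t.toNNReal) (hf0 : ∀ t, 0 ≤ f t)
    {C : ℝ} (hC : ∀ t, f t ≤ C) (t : ℝ≥0) : (clock f t : ℝ) ≤ C * t := by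
  have hCa : ∀ t : ℝ, |f t.toNNReal| ≤ C := fun t => by rw [abs_of_nonneg (hf0 _)]; exact hC _
  rw [coe_clock hf0]
  calc ∫ s in (0 : ℝ)..t, f s.toNNReal ≤ ∫ _s in (0 : ℝ)..t, C :=
        intervalIntegral.integral_mono_on t.2 (hf.intervalIntegrable hCa _ _)
          intervalIntegrable_const fun s _ => hC _
    _ = C * t := by simp [mul_comm]

/-! ### Pathwise convergence -/

/-- On the event that the initial state and the four Poisson processes are close to their fluid
values, the scaled path stays close to the fluid solution. -/
theorem exists_path_bound {Ω : Type*} [MeasurableSpace Ω] {P : Measure Ω}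
    {lam mu nu K M : ℝ} (hlam : 0 < lam) (hmu : 0 < mu) (hnu : 0 < nu)
    (hM : 0 < M) (hMK : M ≤ K) {z : ℝ≥0 → ℝ} (hz : IsFluidSolution lam mu nu K M z)
    {T : ℝ≥0} (hT : 0 < T) {ε : ℝ} (hε : 0 < ε) :
    ∃ b > 0, ∀ (n : ℕ+) (cap : ℕ), 1 / (n : ℝ) ≤ b → (cap : ℝ) ≤ n * K → (n : ℝ) * K - cap ≤ 1 →
      ∀ (S : Station P cap ((n : ℝ) * lam) mu nu ((n : ℝ) * M)) (ω : Ω),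
      (∀ t, (S.Q t ω : ℤ) = S.Q 0 ω
        + S.Nlam (clock (fun s => if S.Q s ω < cap then 1 else 0) t) ω
        - S.Nnu1 (clock (fun s => S.Z s ω) t) ω
        - S.Nnu2 (clock (fun s => (S.Q s ω : ℝ) - S.Z s ω) t) ω) →
      (∀ t, (S.Z t ω : ℤ) = S.Z 0 ω
        + S.Nlam (clock (fun s => if S.Q s ω < cap then 1 else 0) t) ω
        - S.Nmu (clock (fun s => min (S.Z s ω : ℝ) ((n : ℝ) * M)) t) ω
        - S.Nnu1 (clock (fun s => S.Z s ω) t) ω) →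
      |(S.Z 0 ω : ℝ) / n - z 0| ≤ b → |(S.Q 0 ω : ℝ) / n - K| ≤ b →
      (∀ s ≤ T, |(S.Nlam s ω : ℝ) - (n : ℝ) * lam * s| ≤ b * n) →
      (∀ s ≤ (n : ℝ≥0) * K.toNNReal * T, |(S.Nmu s ω : ℝ) - mu * s| ≤ b * n) →
      (∀ s ≤ (n : ℝ≥0) * K.toNNReal * T, |(S.Nnu1 s ω : ℝ) - nu * s| ≤ b * n) →
      (∀ s ≤ (n : ℝ≥0) * K.toNNReal * T, |(S.Nnu2 s ω : ℝ) - nu * s| ≤ b * n) →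
      ∀ t ≤ T, |(S.Z t ω : ℝ) / n - z t| ≤ ε := by
  have hK : 0 < K := hM.trans_le hMK
  have hT' : (0 : ℝ) < T := hT
  set δ := ε / Real.exp ((mu + nu) * T) with hδ
  have hδ0 : 0 < δ := by positivity
  obtain ⟨b₁, hb₁, hidle⟩ := exists_abs_idle_sub_le hlam hnu hK hT' (half_pos hδ0)
  -- Each equation collects four errors of size `b`: the initial value and three Poisson terms. For
  -- `Q` the total must be at most `b₁`; for `Z` at most `δ / 2`, the other half being the idle-time
  -- error.
  refine ⟨min (b₁ / 4) (δ / 8), by positivity, ?_⟩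
  set b := min (b₁ / 4) (δ / 8)
  have hbb : b ≤ b₁ / 4 := min_le_left _ _
  have hbδ : b ≤ δ / 8 := min_le_right _ _
  intro n cap hnb hcapK hcapK' S ω eQ eZ hZ0 hQ0 hNlam hNmu hNnu1 hNnu2
  clear_value b
  have hb0 : 0 ≤ b := (abs_nonneg _).trans hZ0
  have hn : (0 : ℝ) < (n : ℕ) := by exact_mod_cast n.pos
  have hQcap : ∀ t, (S.Q t ω : ℝ) ≤ cap := fun t => by exact_mod_cast S.Q_le_cap t ω
  have hZQ : ∀ t, (S.Z t ω : ℝ) ≤ S.Q t ω := fun t => by exact_mod_cast S.Z_le_Q t ω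
  have hQr := rightCts_of_isCadlag (S.cadlag_Q ω)
  have hZr := rightCts_of_isCadlag (S.cadlag_Z ω)
  set q : ℝ → ℝ := fun t => (S.Q t.toNNReal ω : ℝ) / n with hq
  set x : ℝ → ℝ := fun t => (S.Z t.toNNReal ω : ℝ) / n with hx
  set i : ℝ → ℝ := fun t => if S.Q t.toNNReal ω < cap then 1 else 0 with hi
  have hqr : RightCts q := fun t => (hQr t).div_const _
  have hxr : RightCts x := fun t => (hZr t).div_const _
  have hir : RightCts i := by
    -- As `Q` is integer-valued and at most `cap`, the indicator is a continuous function of `Q`,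
    -- hence right continuous.
    have : i = fun t => min ((cap : ℝ) - S.Q t.toNNReal ω) 1 := by
      funext t
      simp only [hi]
      split_ifs with h
      · have : (S.Q t.toNNReal ω : ℝ) + 1 ≤ cap := by exact_mod_cast h
        rw [min_eq_right (by linarith)]
      · have : (cap : ℝ) ≤ S.Q t.toNNReal ω := by exact_mod_cast not_lt.1 h
        rw [min_eq_left (by linarith [hQcap t.toNNReal])]
        linarith [hQcap t.toNNReal]
    rw [this]
    exact fun t => (continuousWithinAt_const.sub (hQr t)).min continuousWithinAt_const
  have hx0 : ∀ t, 0 ≤ x t := fun t => by positivity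
  have hq0 : ∀ t, 0 ≤ q t := fun t => by positivity
  have hqcap : ∀ t, q t ≤ cap / n := fun t => div_le_div_of_nonneg_right (hQcap _) hn.le
  have hcapn : (cap : ℝ) / n ≤ K := by rw [div_le_iff₀ hn]; linarith
  have hxq : ∀ t, x t ≤ q t := fun t => div_le_div_of_nonneg_right (hZQ _) hn.le
  have hqK : ∀ t, q t ≤ K := fun t => (hqcap t).trans hcapn
  have hxK : ∀ t, x t ≤ K := fun t => (hxq t).trans (hqK t)
  have hmr : RightCts fun t => min (S.Z t.toNNReal ω : ℝ) (n * M) := fun t =>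
    (hZr t).min continuousWithinAt_const
  have hL : ∀ f : ℝ≥0 → ℝ, RightCts (fun t => f t.toNNReal) → (∀ t, 0 ≤ f t) →
      (∀ t, f t ≤ n * K) → ∀ t ≤ T, clock f t ≤ (n : ℝ≥0) * K.toNNReal * T :=
    fun f hf hf0 hfK t ht => by
      rw [← NNReal.coe_le_coe]
      refine (clock_le hf hf0 hfK t).trans ?_
      push_cast
      rw [Real.coe_toNNReal K hK.le]
      exact mul_le_mul_of_nonneg_left ht (by positivity)
  have hqi : ∀ a b : ℝ, IntervalIntegrable q volume a b :=
    hqr.intervalIntegrable (C := K) fun t => by rw [abs_of_nonneg (hq0 t)]; exact hqK t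
  have hxi : ∀ a b : ℝ, IntervalIntegrable x volume a b :=
    hxr.intervalIntegrable (C := K) fun t => by rw [abs_of_nonneg (hx0 t)]; exact hxK t
  have hZn : ∀ t : ℝ, (S.Z t.toNNReal ω : ℝ) = n * x t := fun t => by
    simp only [hx]; field_simp
  have hQn : ∀ t : ℝ, (S.Q t.toNNReal ω : ℝ) = n * q t := fun t => by
    simp only [hq]; field_simp
  have hcA : ∀ t : ℝ≥0, (clock (fun s => if S.Q s ω < cap then 1 else 0) t : ℝ) =
      ∫ s in (0 : ℝ)..t, i s := coe_clock (fun t => by positivity)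
  have hcZ : ∀ t : ℝ≥0, (clock (fun s => (S.Z s ω : ℝ)) t : ℝ) = n * ∫ s in (0 : ℝ)..t, x s :=
    fun t => by
      rw [coe_clock (fun t => by positivity), ← intervalIntegral.integral_const_mul]
      simp only [hZn]
  have hcQ : ∀ t : ℝ≥0, (clock (fun s => (S.Q s ω : ℝ) - S.Z s ω) t : ℝ) =
      n * ((∫ s in (0 : ℝ)..t, q s) - ∫ s in (0 : ℝ)..t, x s) := fun t => by
    rw [coe_clock (fun t => sub_nonneg.2 (hZQ t)),
      ← intervalIntegral.integral_sub (hqi _ _) (hxi _ _), ← intervalIntegral.integral_const_mul]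
    simp only [hZn, hQn, mul_sub]
  have hcM : ∀ t : ℝ≥0, (clock (fun s => min (S.Z s ω : ℝ) (n * M)) t : ℝ) =
      n * ∫ s in (0 : ℝ)..t, min (x s) M := fun t => by
    rw [coe_clock (fun t => by positivity), ← intervalIntegral.integral_const_mul]
    simp only [hZn, mul_min_of_nonneg _ _ hn.le]
  have bA : ∀ t ≤ T, |(S.Nlam (clock (fun s => if S.Q s ω < cap then 1 else 0) t) ω : ℝ)
      - n * lam * ∫ s in (0 : ℝ)..t, i s| ≤ b * n := fun t ht => by
    rw [← hcA]
    refine hNlam _ ?_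
    rw [← NNReal.coe_le_coe]
    refine (clock_le (C := 1) hir (fun t => by positivity)
      (fun t => by split_ifs <;> norm_num) t).trans ?_
    simpa using ht
  have bM : ∀ t ≤ T, |(S.Nmu (clock (fun s => min (S.Z s ω : ℝ) (n * M)) t) ω : ℝ)
      - mu * (n * ∫ s in (0 : ℝ)..t, min (x s) M)| ≤ b * n := fun t ht => by
    rw [← hcM]
    exact hNmu _ (hL _ hmr (fun t => by positivity)
      (fun t => (min_le_left _ _).trans ((hZQ t).trans ((hQcap t).trans hcapK))) t ht)
  have bZ : ∀ t ≤ T, |(S.Nnu1 (clock (fun s => (S.Z s ω : ℝ)) t) ω : ℝ)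
      - nu * (n * ∫ s in (0 : ℝ)..t, x s)| ≤ b * n := fun t ht => by
    rw [← hcZ]
    exact hNnu1 _ (hL _ hZr (fun t => by positivity)
      (fun t => (hZQ t).trans ((hQcap t).trans hcapK)) t ht)
  have bQ : ∀ t ≤ T, |(S.Nnu2 (clock (fun s => (S.Q s ω : ℝ) - S.Z s ω) t) ω : ℝ)
      - nu * (n * ((∫ s in (0 : ℝ)..t, q s) - ∫ s in (0 : ℝ)..t, x s))| ≤ b * n := fun t ht => by
    rw [← hcQ]
    exact hNnu2 _ (hL _ (fun t => (hQr t).sub (hZr t)) (fun t => sub_nonneg.2 (hZQ t))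
      (fun t => by linarith [hQcap t, (Nat.cast_nonneg (S.Z t ω) : (0 : ℝ) ≤ _)]) t ht)
  have eQ' : ∀ t, (S.Q t ω : ℝ) = S.Q 0 ω
        + S.Nlam (clock (fun s => if S.Q s ω < cap then 1 else 0) t) ω
        - S.Nnu1 (clock (fun s => S.Z s ω) t) ω
        - S.Nnu2 (clock (fun s => (S.Q s ω : ℝ) - S.Z s ω) t) ω := fun t => by
    have := congrArg (Int.cast : ℤ → ℝ) (eQ t)
    push_cast at this
    exact this
  have eZ' : ∀ t, (S.Z t ω : ℝ) = S.Z 0 ω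
        + S.Nlam (clock (fun s => if S.Q s ω < cap then 1 else 0) t) ω
        - S.Nmu (clock (fun s => min (S.Z s ω : ℝ) (n * M)) t) ω
        - S.Nnu1 (clock (fun s => S.Z s ω) t) ω := fun t => by
    have := congrArg (Int.cast : ℤ → ℝ) (eZ t)
    push_cast at this
    exact this
  have scale : ∀ {u c : ℝ}, |n * u| ≤ c * n → |u| ≤ c := fun {u c} h => by
    rw [abs_mul, abs_of_pos hn, mul_comm] at h
    exact le_of_mul_le_mul_right h hn
  have hQ0n : |(S.Q 0 ω : ℝ) - n * K| ≤ b * n := by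
    rw [show (S.Q 0 ω : ℝ) - n * K = n * ((S.Q 0 ω : ℝ) / n - K) by field_simp, abs_mul,
      abs_of_pos hn, mul_comm]
    exact mul_le_mul_of_nonneg_right hQ0 hn.le
  have hZ0n : |(S.Z 0 ω : ℝ) - n * z 0| ≤ b * n := by
    rw [show (S.Z 0 ω : ℝ) - n * z 0 = n * ((S.Z 0 ω : ℝ) / n - z 0) by field_simp, abs_mul,
      abs_of_pos hn, mul_comm]
    exact mul_le_mul_of_nonneg_right hZ0 hn.le
  -- The clocks driven by `Z` and `Q - Z` sum to `n * ∫ q`, so only `q` and `i` remain.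
  have hidle' := hidle q i (cap / n) hqr hir hq0 hqcap hcapn
    (by
      have : K - (cap : ℝ) / n ≤ 1 / n := by
        rw [le_div_iff₀ hn, sub_mul, div_mul_cancel₀ _ hn.ne']; linarith
      linarith)
    (fun t => by
      simp only [hi, hq, div_lt_div_iff_of_pos_right hn, Nat.cast_lt])
    (fun t ht => by
      lift t to ℝ≥0 using ht.1
      have htT : t ≤ T := ht.2
      refine scale ?_
      have h1 := abs_le.1 hQ0n
      have h2 := abs_le.1 (bA t htT)
      have h3 := abs_le.1 (bZ t htT)
      have h4 := abs_le.1 (bQ t htT)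
      have h5 := eQ' t
      have h6 := hQn t
      rw [Real.toNNReal_coe] at h6
      have h7 := mul_le_mul_of_nonneg_right hbb hn.le
      refine abs_le.2 ⟨?_, ?_⟩ <;> linarith)
  have hfluid := abs_sub_fluid_le (r := min lam (nu * K)) (z₀ := z 0) (T := T) (δ := δ) hmu hnu hM
    hxr hx0 hxK (hz.continuous.comp continuous_real_toNNReal) (by simp)
    (fun t ht => hz.hasDerivWithinAt ht)
    (fun t ht => by
      have h0 := abs_le.1 (hidle' t ht)
      lift t to ℝ≥0 using ht.1
      have htT : t ≤ T := ht.2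
      refine scale ?_
      have h1 := abs_le.1 hZ0n
      have h2 := abs_le.1 (bA t htT)
      have h3 := abs_le.1 (bZ t htT)
      have h4 := abs_le.1 (bM t htT)
      have h5 := eZ' t
      have h6 := hZn t
      rw [Real.toNNReal_coe] at h6
      have h7 := mul_le_mul_of_nonneg_right hbδ hn.le
      have h8 := mul_le_mul_of_nonneg_right h0.1 hn.le
      have h9 := mul_le_mul_of_nonneg_right h0.2 hn.le
      refine abs_le.2 ⟨?_, ?_⟩ <;> linarith)
  intro t ht
  have h := hfluid t ⟨t.2, ht⟩
  rw [hδ, div_mul_cancel₀ _ (Real.exp_pos _).ne'] at h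
  simpa [hx] using h

/-! ### Convergence in probability in the Skorokhod space -/

/-- Convergence in distribution to a constant implies convergence in probability. -/
theorem tendsto_measure_of_tendstoInDistribution_const {Ω : Type*} [MeasurableSpace Ω]
    {P : Measure Ω} [IsProbabilityMeasure P] {X : ℕ+ → Ω → ℝ} {c : ℝ}
    (h : TendstoInDistribution X atTop (fun _ : Ω => c) (fun _ => P) P) {b : ℝ} (hb : 0 < b) :
    Tendsto (fun n => P {ω | b < |X n ω - c|}) atTop (𝓝 0) := by
  set F : Set ℝ := {x | b ≤ |x - c|} with hF
  have hFc : IsClosed F := isClosed_le continuous_const (by fun_prop)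
  -- Portmanteau for the closed set `F`, which the limiting point mass does not charge.
  have hl := ProbabilityMeasure.limsup_measure_closed_le_of_tendsto h.tendsto hFc
  have h0 : (P.map fun _ : Ω => c) F = 0 := by
    rw [Measure.map_apply measurable_const hFc.measurableSet]
    have : (fun _ : Ω => c) ⁻¹' F = ∅ := by
      ext ω; simp [hF, hb]
    rw [this, measure_empty]
  have hl' : limsup (fun n => (P.map (X n)) F) atTop ≤ 0 := hl.trans h0.le
  have hz : Tendsto (fun n => (P.map (X n)) F) atTop (𝓝 0) :=
    tendsto_of_le_liminf_of_limsup_le zero_le hl'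
  refine tendsto_of_tendsto_of_tendsto_of_le_of_le tendsto_const_nhds hz (fun _ => zero_le)
    fun n => ?_
  change _ ≤ (P.map (X n)) F
  rw [Measure.map_apply_of_aemeasurable (h.forall_aemeasurable n) hFc.measurableSet]
  refine measure_mono fun ω hω => ?_
  have hω' : b < |X n ω - c| := hω
  exact hω'.le

/-- The identity time change shows that uniform distance dominates `J₁` distance. -/
theorem Skorokhod.edist_le_of_forall {T : ℝ≥0} {x y : Skorokhod T} {ε : ℝ≥0∞}
    (h : ∀ t, edist (x.1 t) (y.1 t) ≤ ε) : edist x y ≤ ε :=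
  iInf_le_of_le (OrderIso.refl _) (max_le (by simp) (iSup_le h))

/-- Division by a constant on the Skorokhod space. -/
noncomputable def Skorokhod.divConst {T : ℝ≥0} (c : ℝ) (x : Skorokhod T) : Skorokhod T :=
  ⟨fun t => x.1 t / c, x.2.div_const c⟩

/-- For `c ≥ 1` division shrinks the space part of each cost and leaves the time part alone, so it
is 1-Lipschitz. This transfers measurability from the unscaled path. -/
theorem Skorokhod.measurable_divConst {T : ℝ≥0} {c : ℝ} (hc : 1 ≤ c) :
    Measurable (Skorokhod.divConst (T := T) c) := by
  have h : LipschitzWith 1 (Skorokhod.divConst (T := T) c) := fun x y => by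
    rw [ENNReal.coe_one, one_mul]
    refine iInf_mono fun γ => max_le_max le_rfl (iSup_mono fun t => ?_)
    change edist (x.1 t / c) (y.1 (γ t) / c) ≤ _
    rw [edist_dist, edist_dist, Real.dist_eq, Real.dist_eq, ← sub_div, abs_div,
      abs_of_pos (by linarith : (0 : ℝ) < c)]
    exact ENNReal.ofReal_le_ofReal (div_le_self (abs_nonneg _) hc)
  exact h.continuous.measurable

theorem Station.measurable_scaledPath {Ω : Type*} [MeasurableSpace Ω] {P : Measure Ω} {cap : ℕ}
    {lam mu nu M : ℝ} (S : Station P cap lam mu nu M) {c : ℝ} (hc : 1 ≤ c) (T : ℝ≥0) :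
    Measurable (S.scaledPath c T) :=
  (Skorokhod.measurable_divConst hc).comp (S.measurable_path_Z T)

/-- A limit outside the interval would keep a positive distance from every `X n` with probability
one. This places `z₀` in `[0, K]`. -/
theorem mem_Icc_of_tendstoInDistribution {Ω : Type*} [MeasurableSpace Ω]
    {P : Measure Ω} [IsProbabilityMeasure P] {X : ℕ+ → Ω → ℝ} {a b c : ℝ}
    (h : TendstoInDistribution X atTop (fun _ : Ω => c) (fun _ => P) P)
    (hX : ∀ n ω, X n ω ∈ Set.Icc a b) : c ∈ Set.Icc a b := by
  have key : ∀ d > 0, ¬ ∀ x ∈ Set.Icc a b, d < |x - c| := fun d hd hall => by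
    have ht := tendsto_measure_of_tendstoInDistribution_const h hd
    have h1 : ∀ n, P {ω | d < |X n ω - c|} = 1 := fun n => by
      rw [show {ω | d < |X n ω - c|} = Set.univ from
        Set.eq_univ_of_forall fun ω => hall _ (hX n ω), measure_univ]
    simp only [h1] at ht
    exact one_ne_zero (tendsto_nhds_unique ht tendsto_const_nhds).symm
  constructor
  · by_contra! hc
    exact key ((a - c) / 2) (by linarith) fun x hx => by
      rw [abs_of_nonneg (by linarith [hx.1])]; linarith [hx.1]
  · by_contra! hc
    exact key ((c - b) / 2) (by linarith) fun x hx => by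
      rw [abs_of_nonpos (by linarith [hx.2])]; linarith [hx.2]

theorem tendstoInMeasure_scaledPath {Ω : Type*} [MeasurableSpace Ω] {P : Measure Ω}
    [IsProbabilityMeasure P] {lam mu nu K M : ℝ} (hlam : 0 < lam) (hmu : 0 < mu) (hnu : 0 < nu)
    (hM : 0 < M) (hMK : M ≤ K)
    (S : (n : ℕ+) → Station P ⌊(n : ℝ) * K⌋₊ ((n : ℝ) * lam) mu nu ((n : ℝ) * M))
    {z : ℝ≥0 → ℝ} (hz : IsFluidSolution lam mu nu K M z)
    (hZ : TendstoInDistribution (fun (n : ℕ+) ω => ((S n).Z 0 ω : ℝ) / n) atTop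
      (fun _ : Ω => z 0) (fun _ => P) P)
    (hQ : TendstoInDistribution (fun (n : ℕ+) ω => ((S n).Q 0 ω : ℝ) / n) atTop
      (fun _ : Ω => K) (fun _ => P) P) {T : ℝ≥0} (hT : 0 < T) :
    TendstoInMeasure P (fun (n : ℕ+) ω => (S n).scaledPath n T ω) atTop
      (fun _ : Ω => Skorokhod.restrict T z (isCadlag_of_continuous hz.continuous)) := by
  have hK : 0 < K := hM.trans_le hMK
  intro ε hε
  -- `ε` may be infinite; a finite `ε' < ε` feeds the real-valued path bound, and strictness gives
  -- the contradiction at the end.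
  obtain ⟨ε', hε', hε'ε⟩ := ENNReal.lt_iff_exists_nnreal_btwn.1 hε
  have hε'0 : (0 : ℝ) < ε' := by exact_mod_cast hε'
  obtain ⟨b, hb, hpath⟩ := exists_path_bound (P := P) hlam hmu hnu hM hMK hz hT hε'0
  have t1 := tendsto_measure_of_tendstoInDistribution_const hZ hb
  have t2 := tendsto_measure_of_tendstoInDistribution_const hQ hb
  have t3 := tendsto_measure_poisson_dev (P := P) (fun n : ℕ+ => by positivity)
    (fun n => (S n).poisson_lam) (L := fun _ => T) (C := lam * T) (fun n => by linarith) hb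
  have hLn : ∀ r : ℝ, ∀ n : ℕ+, r * (((n : ℝ≥0) * K.toNNReal * T : ℝ≥0) : ℝ) ≤ r * K * T * n :=
    fun r n => by
      push_cast; rw [Real.coe_toNNReal K hK.le]; exact le_of_eq (by ring)
  have t4 := tendsto_measure_poisson_dev (P := P) (fun _ : ℕ+ => hmu.le)
    (fun n => (S n).poisson_mu) (hLn mu) hb
  have t5 := tendsto_measure_poisson_dev (P := P) (fun _ : ℕ+ => hnu.le)
    (fun n => (S n).poisson_nu1) (hLn nu) hb
  have t6 := tendsto_measure_poisson_dev (P := P) (fun _ : ℕ+ => hnu.le)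
    (fun n => (S n).poisson_nu2) (hLn nu) hb
  have tsum := ((((t1.add t2).add t3).add t4).add t5).add t6
  simp only [add_zero] at tsum
  have hlarge : ∀ᶠ n : ℕ+ in atTop, 1 / (n : ℝ) ≤ b :=
    (tendsto_one_div_atTop_nhds_zero_nat (𝕜 := ℝ)).comp tendsto_PNat_val_atTop_atTop
      |>.eventually (ge_mem_nhds hb)
  refine tendsto_of_tendsto_of_tendsto_of_le_of_le' tendsto_const_nhds tsum
    (Eventually.of_forall fun _ => zero_le) ?_
  filter_upwards [hlarge] with n hn
  -- Almost surely, a large deviation of the path forces one of six bad events: two for the initial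
  -- state, four for the Poisson processes.
  refine le_trans (measure_mono_ae ?_) ((measure_union_le _ _).trans (add_le_add_left
    ((measure_union_le _ _).trans (add_le_add_left ((measure_union_le _ _).trans (add_le_add_left
    ((measure_union_le _ _).trans (add_le_add_left (measure_union_le _ _) _)) _)) _)) _))
  filter_upwards [(S n).eq_Q, (S n).eq_Z] with ω eQ eZ
  intro hω
  by_contra hcon
  have hcon' : ¬ (((((b < |((S n).Z 0 ω : ℝ) / n - z 0| ∨ b < |((S n).Q 0 ω : ℝ) / n - K|) ∨
      ∃ s ≤ T, b * n < |((S n).Nlam s ω : ℝ) - (n : ℝ) * lam * s|) ∨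
      ∃ s ≤ (n : ℝ≥0) * K.toNNReal * T, b * n < |((S n).Nmu s ω : ℝ) - mu * s|) ∨
      ∃ s ≤ (n : ℝ≥0) * K.toNNReal * T, b * n < |((S n).Nnu1 s ω : ℝ) - nu * s|) ∨
      ∃ s ≤ (n : ℝ≥0) * K.toNNReal * T, b * n < |((S n).Nnu2 s ω : ℝ) - nu * s|) := hcon
  push Not at hcon'
  obtain ⟨⟨⟨⟨⟨c1, c2⟩, c3⟩, c4⟩, c5⟩, c6⟩ := hcon'
  have hp := hpath n _ hn (Nat.floor_le (by positivity))
    (by linarith [(Nat.lt_floor_add_one ((n : ℝ) * K)).le]) (S n) ω eQ eZ c1 c2 c3 c4 c5 c6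
  have hle : edist ((S n).scaledPath n T ω)
      (Skorokhod.restrict T z (isCadlag_of_continuous hz.continuous)) ≤ ε' := by
    refine Skorokhod.edist_le_of_forall fun t => ?_
    change edist (((S n).Z t ω : ℝ) / n) (z t) ≤ _
    rw [edist_dist, Real.dist_eq, ENNReal.ofReal_le_iff_le_toReal ENNReal.coe_ne_top]
    exact hp t t.2.2
  have hω' : ε ≤ edist ((S n).scaledPath n T ω)
      (Skorokhod.restrict T z (isCadlag_of_continuous hz.continuous)) := hω
  exact absurd (hω'.trans hle) (not_le.2 hε'ε)

end EVCharging

theorem mainTheorem4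
    {Ω : Type*} [MeasurableSpace Ω] (P : Measure Ω) [IsProbabilityMeasure P]
    (lam mu nu K M : ℝ) (hlam : 0 < lam) (hmu : 0 < mu) (hnu : 0 < nu)
    (hM : 0 < M) (hMK : M ≤ K)
    (S : (n : ℕ+) → EVCharging.Station P ⌊(n : ℝ) * K⌋₊ ((n : ℝ) * lam) mu nu ((n : ℝ) * M))
    (z₀ : ℝ)
    (hZ : TendstoInDistribution (fun (n : ℕ+) ω => ((S n).Z 0 ω : ℝ) / n) atTop
      (fun _ : Ω => z₀) (fun _ => P) P)
    (hQ : TendstoInDistribution (fun (n : ℕ+) ω => ((S n).Q 0 ω : ℝ) / n) atTop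
      (fun _ : Ω => K) (fun _ => P) P) :
    ∃ (z : ℝ≥0 → ℝ) (hz : EVCharging.IsFluidSolution lam mu nu K M z),
      z 0 = z₀ ∧
      (∀ y, EVCharging.IsFluidSolution lam mu nu K M y → y 0 = z₀ → y = z) ∧
      ∀ T : ℝ≥0, 0 < T →
        TendstoInDistribution (fun (n : ℕ+) ω => (S n).scaledPath n T ω) atTop
          (fun _ : Ω => EVCharging.Skorokhod.restrict T z
            (EVCharging.isCadlag_of_continuous hz.continuous)) (fun _ => P) P := by
  have hK : 0 < K := hM.trans_le hMK
  have hz₀ : z₀ ∈ Set.Icc 0 K :=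
    EVCharging.mem_Icc_of_tendstoInDistribution hZ fun n ω => by
      have hn : (0 : ℝ) < (n : ℕ) := by exact_mod_cast n.pos
      refine ⟨by positivity, ?_⟩
      refine div_le_of_le_mul₀ hn.le hK.le (le_trans ?_ ((Nat.floor_le (by positivity : (0 : ℝ) ≤ (n : ℝ) * K)).trans_eq (mul_comm _ _)))
      exact_mod_cast ((S n).Z_le_Q 0 ω).trans ((S n).Q_le_cap 0 ω)
  obtain ⟨z, hz, hz0⟩ := EVCharging.exists_isFluidSolution hlam hmu hnu hM hMK hz₀
  subst hz0
  refine ⟨z, hz, rfl, fun y hy hy0 => hy.eq_of_initial_eq hmu hnu hz hy0, fun T hT => ?_⟩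
  refine (EVCharging.tendstoInMeasure_scaledPath hlam hmu hnu hM hMK S hz hZ hQ
    hT).tendstoInDistribution fun n => ?_
  exact ((S n).measurable_scaledPath (by exact_mod_cast one_le (a := n)) T).aemeasurable
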